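/- Write $[k]=\{1,\dots,k\}$. For a finite family $\mathcal F$ of sets, let $\nu(\mathcal F)$ be the maximum number of pairwise disjoint distinct members of $\mathcal F$. A family $\mathcal F\subset 2^{[n]}$ is \emph{shifted} if, whenever $\{a_1<\dots<a_k\}\in\mathcal F$ and $\{b_1<\dots<b_k\}\subset[n]$ satisfies $b_i\le a_i$ for all $i$, also $\{b_1,\dots,b_k\}\in\mathcal F$. For integers $m\ge 2$ and $1\le c\le s$ put $n=ms+c$, $\ell=s-c$, and \[ \mathcal Q(m,s,\ell)=\{P\subset[n]: |P|+|P\cap[ms-c-1]|\ge 2m\},\qquad \mathcal W(m,s,\ell)=\{P\subset[n]: |P\cap[ms-1]|\ge m\}. \] For a family $\mathcal F\subset 2^{[n]}$ let $\overline{\mathcal F}=2^{[n]}\setminus\mathcal F$. \textbf{Theorem.} Fix integers $m\ge 2$ and $c\ge 1$. There is a constant $K$, depending only on $m$ and $c$, such that for all $s\ge c$ the following hold with $n=ms+c$ and $\ell=s-c$. (1) Let $\mathcal F\subset 2^{[n]}$ be a shifted family with $\nu(\mathcal F)<s$. Suppose that $\mathcal F\nsubseteq\mathcal Q(m,s,\ell)$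 and, in case $c=1$, also $\mathcal F\nsubseteq\mathcal W(m,s,\ell)$. Then \[ |\overline{\mathcal F}|\ \ge\ (2c+3)\binom{n}{m-1}-K s^{m-2}. \] (2) One has \[ \left|\,|\overline{\mathcal Q(m,s,\ell)}|-(2c+2)\binom{n}{m-1}\right|\ \le\ K s^{m-2}. \] -/

import Mathlib

/-- The matching number `ν(F)`: the largest number of sets in a subfamily of `F` whose members
are pairwise disjoint. -/
def matchingNumber (F : Finset (Finset ℕ)) : ℕ :=
  (F.powerset.filter (fun M => ∀ A ∈ M, ∀ B ∈ M, A ≠ B → Disjoint A B)).sup Finset.card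

/-- `A = {a₁ < ⋯ < aₖ}` can be shifted to `B = {b₁ < ⋯ < bₖ}`: the two sets have the same size and
`bᵢ ≤ aᵢ` for every `i`. -/
def CanShift (A B : Finset ℕ) : Prop :=
  ∃ h : B.card = A.card, ∀ i : Fin A.card, B.orderEmbOfFin h i ≤ A.orderEmbOfFin rfl i

/-- A family `F` of subsets of `[n] = {1, …, n}` is shifted if it contains, with each of its
members `A`, every `B ⊆ [n]` to which `A` can be shifted. -/
def IsShifted (n : ℕ) (F : Finset (Finset ℕ)) : Prop :=
  ∀ A ∈ F, ∀ B ⊆ Finset.Icc 1 n, CanShift A B → B ∈ F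

/-- The complement `2^[n] \ F`: the subsets of `[n]` missing from `F`. -/
def missingSets (n : ℕ) (F : Finset (Finset ℕ)) : Finset (Finset ℕ) :=
  (Finset.Icc 1 n).powerset \ F

/-- The family `Q(m, s, ℓ)`, `ℓ = s - c`, on the ground set `[n]`, `n = ms + c`:
the sets `P ⊆ [n]` with `|P| + |P ∩ [ms - c - 1]| ≥ 2m`. -/
def familyQ (m s c : ℕ) : Finset (Finset ℕ) :=
  (Finset.Icc 1 (m * s + c)).powerset.filter
    (fun P => 2 * m ≤ P.card + (P ∩ Finset.Icc 1 (m * s - c - 1)).card)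

/-- The family `W(m, s, ℓ)`, `ℓ = s - c`, on the ground set `[n]`, `n = ms + c`:
the sets `P ⊆ [n]` with `|P ∩ [ms - 1]| ≥ m`. -/
def familyW (m s c : ℕ) : Finset (Finset ℕ) :=
  (Finset.Icc 1 (m * s + c)).powerset.filter
    (fun P => m ≤ (P ∩ Finset.Icc 1 (m * s - 1)).card)

/-! Let `b = m - 1`, replace `F` by the up-set `G` of its nonempty members, and call the last `t`
elements of `[n]` the tail, the rest the head, with `t` a large constant. A tail set `J` is rich if
it can be completed to a member of `G` by `b` head elements while avoiding any bounded set. Each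
poor `J` costs `G` almost `n.choose b` sets, and different `J` cost different sets
(`card_poorSets_mul_le`). So it suffices to find `2c + 3` poor sets.

Suppose there are at most `2c + 2`, and that `G` misses fewer than `t * k.choose b` sets, as it may
be assumed to. Then large parts of the head split into `m`-sets of `G` (`exists_disjoint_blocks`). A
rich `J` takes only `m - 1` head elements instead of `m`, so `t - c` disjoint rich sets would give
`s` disjoint members of `G`. Counting poor empty sets, singletons and pairs then leaves two patterns
(`rich_dichotomy`): that of `Q`, where singletons outside the last `2c + 1` elements and all pairs
are rich, and for `c = 1` that of `W`. In either pattern a member `D` of `F` outside the model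
family leaves room for `s - 1` disjoint members of `G` avoiding `D`, a contradiction.

For `Q` itself, up to lower order a missing set is `m - 1` head elements with at most one of the
last `2c + 1` elements, hence the factor `2c + 2`. -/

/-! ### Shiftedness, the generated up-set and matchings -/

theorem canShift_image (A : Finset ℕ) (f : ℕ → ℕ) (hf : Set.InjOn f A) (hle : ∀ a ∈ A, f a ≤ a) :
    CanShift A (A.image f) := by
  have h : (A.image f).card = A.card := Finset.card_image_of_injOn hf
  refine ⟨h, fun i => ?_⟩
  by_contra! hlt
  set b := (A.image f).orderEmbOfFin h
  set a := A.orderEmbOfFin rfl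
  -- If `b i > a i`, the `i + 1` images of `a 0, …, a i` lie below `b i`, where only `i` elements of
  -- the image are available.
  have hsub : ((Finset.Iic i).image fun j => f (a j)) ⊆ (Finset.Iio i).image b := by
    intro y hy
    obtain ⟨j, hj, rfl⟩ := Finset.mem_image.1 hy
    have hja : a j ∈ A := Finset.orderEmbOfFin_mem _ _ _
    have hmem : f (a j) ∈ A.image f := Finset.mem_image_of_mem _ hja
    have : f (a j) ∈ Set.range b := by
      rw [Finset.range_orderEmbOfFin]; exact hmem
    obtain ⟨k, hk⟩ := this
    refine Finset.mem_image.2 ⟨k, Finset.mem_Iio.2 ?_, hk⟩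
    have h1 : a j ≤ a i := a.monotone (Finset.mem_Iic.1 hj)
    have h2 := hle _ hja
    exact b.lt_iff_lt.1 (by omega)
  have h1 := Finset.card_le_card hsub
  have hinj : Set.InjOn (fun j => f (a j)) (Finset.Iic i : Set (Fin A.card)) := by
    intro x _ y _ hxy
    exact a.injective (hf (Finset.orderEmbOfFin_mem _ _ _) (Finset.orderEmbOfFin_mem _ _ _) hxy)
  rw [Finset.card_image_of_injOn hinj, Finset.card_image_of_injective _ b.injective] at h1
  simp at h1

/-- A family is domination closed if it contains every `Y ⊆ [n]` admitting an injection
`X → Y` that does not increase any element, for some member `X`. -/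
def DominationClosed (n : ℕ) (G : Finset (Finset ℕ)) : Prop :=
  ∀ X ∈ G, ∀ Y ⊆ Finset.Icc 1 n, ∀ f : ℕ → ℕ, Set.InjOn f X → (∀ x ∈ X, f x ∈ Y ∧ f x ≤ x) → Y ∈ G

/-- The up-set of `2^[n]` generated by the nonempty members of `F`. -/
def upGenerated (n : ℕ) (F : Finset (Finset ℕ)) : Finset (Finset ℕ) :=
  (Finset.Icc 1 n).powerset.filter fun B => ∃ C ∈ F, C.Nonempty ∧ C ⊆ B

theorem mem_upGenerated {n : ℕ} {F : Finset (Finset ℕ)} {B : Finset ℕ} :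
    B ∈ upGenerated n F ↔ B ⊆ Finset.Icc 1 n ∧ ∃ C ∈ F, C.Nonempty ∧ C ⊆ B := by
  simp [upGenerated]

theorem dominationClosed_upGenerated {n : ℕ} {F : Finset (Finset ℕ)} (hF : IsShifted n F) :
    DominationClosed n (upGenerated n F) := by
  intro X hX Y hY f hf hfY
  obtain ⟨-, C, hC, hne, hCX⟩ := mem_upGenerated.1 hX
  have hsub : C.image f ⊆ Y := by
    intro y hy
    obtain ⟨x, hx, rfl⟩ := Finset.mem_image.1 hy
    exact (hfY x (hCX hx)).1
  refine mem_upGenerated.2 ⟨hY, C.image f, hF C hC _ (hsub.trans hY) ?_, hne.image f, hsub⟩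
  exact canShift_image C f (hf.mono (by exact_mod_cast hCX)) fun a ha => (hfY a (hCX ha)).2

/-- Only `∅` can be lost, because it is excluded as a generator; the error term absorbs this one
set. -/
theorem card_missingSets_upGenerated_le (n : ℕ) (F : Finset (Finset ℕ)) :
    (missingSets n (upGenerated n F)).card ≤ (missingSets n F).card + 1 := by
  have : missingSets n (upGenerated n F) ⊆ insert ∅ (missingSets n F) := by
    intro B hB
    simp only [missingSets, Finset.mem_sdiff, Finset.mem_powerset, Finset.mem_insert] at hB ⊢
    rcases B.eq_empty_or_nonempty with h | h
    · exact Or.inl h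
    · exact Or.inr ⟨hB.1, fun hBF => hB.2 (mem_upGenerated.2 ⟨hB.1, B, hBF, h, subset_rfl⟩)⟩
  exact (Finset.card_le_card this).trans (Finset.card_insert_le _ _)

theorem card_le_matchingNumber {F M : Finset (Finset ℕ)} (hM : M ⊆ F)
    (hd : ∀ A ∈ M, ∀ B ∈ M, A ≠ B → Disjoint A B) : M.card ≤ matchingNumber F := by
  unfold matchingNumber
  exact Finset.le_sup (f := Finset.card) (Finset.mem_filter.2 ⟨Finset.mem_powerset.2 hM, hd⟩)

/-- Disjoint members of the generated up-set yield a matching of the original family. -/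
theorem exists_matching_of_upGenerated {ι : Type*} [Fintype ι] {n : ℕ} {F : Finset (Finset ℕ)}
    (g : ι → Finset ℕ) (hg : ∀ i, g i ∈ upGenerated n F) (hd : Pairwise fun i j => Disjoint (g i) (g j)) :
    ∃ M ⊆ F, M.card = Fintype.card ι ∧ (∀ A ∈ M, ∀ B ∈ M, A ≠ B → Disjoint A B) ∧
      ∀ A ∈ M, A.Nonempty ∧ ∃ i, A ⊆ g i := by
  classical
  choose C hCF hne hsub using fun i => (mem_upGenerated.1 (hg i)).2
  have hinj : Function.Injective C := by
    intro i j hij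
    by_contra hne'
    have h1 := (hd hne').mono (hsub i) (hsub j)
    rw [hij] at h1
    exact (hne j).ne_empty (Finset.disjoint_self_iff_empty _ |>.1 h1)
  refine ⟨Finset.univ.image C, ?_, ?_, ?_, ?_⟩
  · intro A hA
    obtain ⟨i, -, rfl⟩ := Finset.mem_image.1 hA
    exact hCF i
  · rw [Finset.card_image_of_injective _ hinj, Finset.card_univ]
  · intro A hA B hB hAB
    obtain ⟨i, -, rfl⟩ := Finset.mem_image.1 hA
    obtain ⟨j, -, rfl⟩ := Finset.mem_image.1 hB
    exact (hd (fun h => hAB (by rw [h]))).mono (hsub i) (hsub j)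
  · intro A hA
    obtain ⟨i, -, rfl⟩ := Finset.mem_image.1 hA
    exact ⟨hne i, i, hsub i⟩

theorem card_le_matchingNumber_of_upGenerated {ι : Type*} [Fintype ι] {n : ℕ}
    {F : Finset (Finset ℕ)} (g : ι → Finset ℕ) (hg : ∀ i, g i ∈ upGenerated n F)
    (hd : Pairwise fun i j => Disjoint (g i) (g j)) : Fintype.card ι ≤ matchingNumber F := by
  obtain ⟨M, hM, hcard, hdM, -⟩ := exists_matching_of_upGenerated g hg hd
  exact hcard ▸ card_le_matchingNumber hM hdM

theorem card_lt_matchingNumber_of_upGenerated {ι : Type*} [Fintype ι] {n : ℕ}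
    {F : Finset (Finset ℕ)} (g : ι → Finset ℕ) (hg : ∀ i, g i ∈ upGenerated n F)
    (hd : Pairwise fun i j => Disjoint (g i) (g j)) {D : Finset ℕ} (hD : D ∈ F)
    (hgD : ∀ i, Disjoint (g i) D) : Fintype.card ι < matchingNumber F := by
  obtain ⟨M, hM, hcard, hdM, hMg⟩ := exists_matching_of_upGenerated g hg hd
  have hMD : ∀ A ∈ M, Disjoint A D := by
    intro A hA
    obtain ⟨-, i, hi⟩ := hMg A hA
    exact (hgD i).mono_left hi
  -- This covers `D = ∅` too, since every member of `M` is nonempty.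
  have hDM : D ∉ M := fun h =>
    (hMg D h).1.ne_empty (Finset.disjoint_self_iff_empty _ |>.1 (hMD D h))
  have := card_le_matchingNumber (F := F) (M := insert D M)
    (Finset.insert_subset hD hM) (by
      intro A hA B hB hAB
      rcases Finset.mem_insert.1 hA with hA' | hA' <;> rcases Finset.mem_insert.1 hB with hB' | hB'
      · exact absurd (hA'.trans hB'.symm) hAB
      · exact hA' ▸ (hMD B hB').symm
      · exact hB' ▸ hMD A hA'
      · exact hdM A hA' B hB' hAB)
  rw [Finset.card_insert_of_notMem hDM] at this
  omega

/-! ### Greedy choice of disjoint sets -/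

theorem exists_disjoint_subsets (U : Finset ℕ) (k b : ℕ) (h : k * b ≤ U.card) :
    ∃ g : Fin k → Finset ℕ, (∀ i, g i ⊆ U ∧ (g i).card = b) ∧
      Pairwise fun i j => Disjoint (g i) (g j) := by
  induction k generalizing U with
  | zero => exact ⟨fun _ => ∅, fun i => i.elim0, fun i => i.elim0⟩
  | succ k ih =>
    obtain ⟨A, hAU, hA⟩ := Finset.exists_subset_card_eq (s := U) (n := b) (by nlinarith)
    obtain ⟨g, hg, hd⟩ := ih (U \ A) (by
      rw [Finset.card_sdiff_of_subset hAU, hA]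
      rw [Nat.succ_mul] at h
      omega)
    have hgA : ∀ i, Disjoint A (g i) := fun i =>
      Finset.disjoint_sdiff.mono_right (hg i).1
    refine ⟨Fin.cons A g, ?_, ?_⟩
    · intro i
      refine Fin.cases ⟨hAU, hA⟩ (fun i => ?_) i
      exact ⟨(hg i).1.trans Finset.sdiff_subset, (hg i).2⟩
    · intro i j
      refine Fin.cases ?_ (fun i => ?_) i <;> refine Fin.cases ?_ (fun j => ?_) j
      · intro h; exact absurd rfl h
      · intro _; exact hgA j
      · intro _; exact (hgA i).symm
      · intro h; exact hd (fun e => h (congrArg Fin.succ e))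

/-- Greedy choice of pairwise disjoint sets avoiding a given set. -/
theorem exists_disjoint_choice {ι : Type*} [Fintype ι] (P : ι → Finset ℕ → Prop) (b R : ℕ)
    (hP : ∀ i, ∀ X : Finset ℕ, X.card ≤ R → ∃ A, P i A ∧ A.card = b ∧ Disjoint A X)
    (D : Finset ℕ) (hD : D.card + Fintype.card ι * b ≤ R) :
    ∃ A : ι → Finset ℕ, (∀ i, P i (A i) ∧ (A i).card = b ∧ Disjoint (A i) D) ∧
      Pairwise fun i j => Disjoint (A i) (A j) := by
  classical
  suffices H : ∀ S : Finset ι, ∃ A : ι → Finset ℕ,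
      (∀ i ∈ S, P i (A i) ∧ (A i).card = b ∧ Disjoint (A i) D) ∧
      ∀ i ∈ S, ∀ j ∈ S, i ≠ j → Disjoint (A i) (A j) by
    obtain ⟨A, h1, h2⟩ := H Finset.univ
    exact ⟨A, fun i => h1 i (Finset.mem_univ i),
      fun i j hij => h2 i (Finset.mem_univ i) j (Finset.mem_univ j) hij⟩
  intro S
  induction S using Finset.induction_on with
  | empty => exact ⟨fun _ => ∅, by simp, by simp⟩
  | insert a S ha ih =>
    obtain ⟨A, h1, h2⟩ := ih
    obtain ⟨B, hB, hBc, hBd⟩ := hP a (D ∪ S.biUnion A) (by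
      have e1 : (S.biUnion A).card ≤ S.card * b :=
        Finset.card_biUnion_le_card_mul _ _ _ fun i hi => (h1 i hi).2.1.le
      have e2 := Finset.card_union_le D (S.biUnion A)
      have e3 : S.card * b ≤ Fintype.card ι * b := Nat.mul_le_mul_right _ (Finset.card_le_univ S)
      omega)
    rw [Finset.disjoint_union_right, Finset.disjoint_biUnion_right] at hBd
    have hne : ∀ i ∈ S, i ≠ a := fun i hi h => ha (h ▸ hi)
    refine ⟨Function.update A a B, ?_, ?_⟩
    · intro i hi
      rcases Finset.mem_insert.1 hi with rfl | hi
      · simpa using ⟨hB, hBc, hBd.1⟩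
      · rw [Function.update_of_ne (hne i hi)]; exact h1 i hi
    · intro i hi j hj hij
      rcases Finset.mem_insert.1 hi with hi' | hi' <;> rcases Finset.mem_insert.1 hj with hj' | hj'
      · exact absurd (hi'.trans hj'.symm) hij
      · rw [hi', Function.update_self, Function.update_of_ne (hne j hj')]; exact hBd.2 j hj'
      · rw [hj', Function.update_self, Function.update_of_ne (hne i hi')]; exact (hBd.2 i hi').symm
      · rw [Function.update_of_ne (hne i hi'), Function.update_of_ne (hne j hj')]
        exact h2 i hi' j hj' hij

/-! ### Rich and poor tail sets -/

/-- `J` is rich if, for every set `X` of at most `R` elements, some `b`-subset of `[n - t]`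
avoiding `X` forms together with `J` a member of `G`. -/
def IsRich (n t b R : ℕ) (G : Finset (Finset ℕ)) (J : Finset ℕ) : Prop :=
  ∀ X : Finset ℕ, X.card ≤ R →
    ∃ A ⊆ Finset.Icc 1 (n - t), A.card = b ∧ Disjoint A X ∧ A ∪ J ∈ G

theorem disjoint_head_tail {n t : ℕ} {A J : Finset ℕ} (hA : A ⊆ Finset.Icc 1 (n - t))
    (hJ : J ⊆ Finset.Ioc (n - t) n) : Disjoint A J := by
  refine Finset.disjoint_left.2 fun x hx hx' => ?_
  have h1 := Finset.mem_Icc.1 (hA hx)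
  have h2 := Finset.mem_Ioc.1 (hJ hx')
  omega

theorem IsRich.dominated {n t b R : ℕ} {G : Finset (Finset ℕ)} (hG : DominationClosed n G)
    {J J' : Finset ℕ} (hJ : IsRich n t b R G J) (hJT : J ⊆ Finset.Ioc (n - t) n)
    (hJT' : J' ⊆ Finset.Ioc (n - t) n) (f : ℕ → ℕ) (hf : Set.InjOn f J)
    (hfJ : ∀ x ∈ J, f x ∈ J' ∧ f x ≤ x) : IsRich n t b R G J' := by
  intro X hX
  obtain ⟨A, hA, hAc, hAX, hAJ⟩ := hJ X hX
  refine ⟨A, hA, hAc, hAX, ?_⟩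
  have hd := Finset.disjoint_left.1 (disjoint_head_tail hA hJT)
  have hd' := Finset.disjoint_left.1 (disjoint_head_tail hA hJT')
  refine hG _ hAJ _ ?_ (fun x => if x ∈ J then f x else x) ?_ ?_
  · intro x hx
    rw [Finset.mem_Icc]
    rcases Finset.mem_union.1 hx with hx | hx
    · have := Finset.mem_Icc.1 (hA hx); omega
    · have := Finset.mem_Ioc.1 (hJT' hx); omega
  · intro x hx y hy hxy
    simp only [Finset.coe_union, Set.mem_union, Finset.mem_coe] at hx hy
    by_cases hxJ : x ∈ J <;> by_cases hyJ : y ∈ J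
    · simp only [hxJ, hyJ, if_true] at hxy; exact hf hxJ hyJ hxy
    · simp only [hxJ, hyJ, if_true, if_false] at hxy
      exact absurd (hxy ▸ (hfJ x hxJ).1) (hd' (hy.resolve_right hyJ))
    · simp only [hxJ, hyJ, if_true, if_false] at hxy
      exact absurd (hxy ▸ (hfJ y hyJ).1) (hd' (hx.resolve_right hxJ))
    · simpa only [hxJ, hyJ, if_false] using hxy
  · intro x hx
    by_cases hxJ : x ∈ J
    · simp only [hxJ, if_true]
      exact ⟨Finset.mem_union_right _ (hfJ x hxJ).1, (hfJ x hxJ).2⟩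
    · simp only [hxJ, if_false]
      exact ⟨Finset.mem_union_left _ ((Finset.mem_union.1 hx).resolve_right hxJ), le_rfl⟩

open Classical in
/-- The subsets of the last `t` elements of `[n]` that are not rich. -/
noncomputable def poorSets (n t b R : ℕ) (G : Finset (Finset ℕ)) : Finset (Finset ℕ) :=
  (Finset.Ioc (n - t) n).powerset.filter fun J => ¬ IsRich n t b R G J

theorem mem_poorSets {n t b R : ℕ} {G : Finset (Finset ℕ)} {J : Finset ℕ} :
    J ∈ poorSets n t b R G ↔ J ⊆ Finset.Ioc (n - t) n ∧ ¬ IsRich n t b R G J := by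
  simp [poorSets]

theorem inter_tail {n t : ℕ} {A J : Finset ℕ} (hA : A ⊆ Finset.Icc 1 (n - t))
    (hJ : J ⊆ Finset.Ioc (n - t) n) : (A ∪ J) ∩ Finset.Ioc (n - t) n = J := by
  rw [Finset.union_inter_distrib_right, Finset.inter_eq_left.2 hJ,
    Finset.disjoint_iff_inter_eq_empty.1 (disjoint_head_tail hA subset_rfl), Finset.empty_union]

theorem inter_head {n t : ℕ} {A J : Finset ℕ} (hA : A ⊆ Finset.Icc 1 (n - t))
    (hJ : J ⊆ Finset.Ioc (n - t) n) : (A ∪ J) ∩ Finset.Icc 1 (n - t) = A := by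
  rw [Finset.union_inter_distrib_right, Finset.inter_eq_left.2 hA, Finset.inter_comm J,
    Finset.disjoint_iff_inter_eq_empty.1 (disjoint_head_tail subset_rfl hJ), Finset.union_empty]

theorem union_subset_Icc {n t : ℕ} {A J : Finset ℕ} (hA : A ⊆ Finset.Icc 1 (n - t))
    (hJ : J ⊆ Finset.Ioc (n - t) n) : A ∪ J ⊆ Finset.Icc 1 n := by
  intro x hx
  rw [Finset.mem_Icc]
  rcases Finset.mem_union.1 hx with hx | hx
  · have := Finset.mem_Icc.1 (hA hx); omega
  · have := Finset.mem_Ioc.1 (hJ hx); omega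

/-- If `X` witnesses that `J` is poor, every `b`-subset of the head off `X` forms a missing set with
`J`. The trace on the tail recovers `J`, so nothing is counted twice. -/
theorem card_poorSets_mul_le (n t b R : ℕ) (G : Finset (Finset ℕ)) :
    (poorSets n t b R G).card * (n - t - R).choose b ≤ (missingSets n G).card := by
  classical
  set S := (missingSets n G).filter fun B => B ∩ Finset.Ioc (n - t) n ∈ poorSets n t b R G
  have hmaps : ∀ B ∈ S, B ∩ Finset.Ioc (n - t) n ∈ poorSets n t b R G := fun B hB =>
    (Finset.mem_filter.1 hB).2
  refine le_trans ?_ (Finset.card_filter_le (missingSets n G)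
    fun B => B ∩ Finset.Ioc (n - t) n ∈ poorSets n t b R G)
  rw [Finset.card_eq_sum_card_fiberwise hmaps, ← smul_eq_mul]
  refine Finset.card_nsmul_le_sum _ _ _ fun J hJ => ?_
  obtain ⟨hJT, hJr⟩ := mem_poorSets.1 hJ
  unfold IsRich at hJr
  push Not at hJr
  obtain ⟨X, hX, hXA⟩ := hJr
  have hcard : (n - t - R).choose b ≤ (((Finset.Icc 1 (n - t)) \ X).powersetCard b).card := by
    rw [Finset.card_powersetCard]
    apply Nat.choose_le_choose
    have := Finset.le_card_sdiff X (Finset.Icc 1 (n - t))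
    rw [Nat.card_Icc] at this
    omega
  refine hcard.trans (Finset.card_le_card_of_injOn (fun A => A ∪ J) ?_ ?_)
  · intro A hA
    obtain ⟨hA1, hA2⟩ := Finset.mem_powersetCard.1 hA
    have hA3 := hA1.trans Finset.sdiff_subset
    have hA4 : Disjoint A X := Finset.sdiff_disjoint.mono_left hA1
    have hi := inter_tail hA3 hJT
    refine Finset.mem_coe.2 (Finset.mem_filter.2 ⟨Finset.mem_filter.2 ⟨?_, ?_⟩, hi⟩)
    · exact Finset.mem_sdiff.2 ⟨Finset.mem_powerset.2 (union_subset_Icc hA3 hJT),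
        hXA A hA3 hA2 hA4⟩
    · dsimp only; rw [hi]; exact hJ
  · intro A hA A' hA' h
    have hA3 := (Finset.mem_powersetCard.1 hA).1.trans Finset.sdiff_subset
    have hA3' := (Finset.mem_powersetCard.1 hA').1.trans Finset.sdiff_subset
    rw [← inter_head hA3 hJT, ← inter_head hA3' hJT]
    exact congrArg (· ∩ Finset.Icc 1 (n - t)) h

/-! ### Building many disjoint members -/

/-- A set with largest element in `[n - t]` and all others in `[n - t - k]` belongs to `G`,
unless `G` misses many sets. -/
theorem mem_of_card_missingSets_lt {n t b k : ℕ} {G : Finset (Finset ℕ)}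
    (hG : DominationClosed n G) (htk : t + k ≤ n)
    (hlt : (missingSets n G).card < t * k.choose b) {A : Finset ℕ} {u : ℕ}
    (hA : A ⊆ Finset.Icc 1 (n - t - k)) (hAc : A.card = b) (hu : u ∈ Finset.Icc 1 (n - t))
    (huA : u ∉ A) : insert u A ∈ G := by
  classical
  by_contra hnot
  refine absurd hlt (not_lt.2 ?_)
  have hAu : insert u A ⊆ Finset.Icc 1 n := by
    intro x hx
    rw [Finset.mem_Icc] at hu ⊢
    rcases Finset.mem_insert.1 hx with rfl | hx
    · omega
    · have := Finset.mem_Icc.1 (hA hx); omega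
  -- A tail element together with `b` of the last `k` head elements dominates `insert u A`; if the
  -- latter were missing, all these sets would be.
  have hcard : (Finset.Ioc (n - t) n ×ˢ (Finset.Ioc (n - t - k) (n - t)).powersetCard b).card
      = t * k.choose b := by
    rw [Finset.card_product, Finset.card_powersetCard, Nat.card_Ioc, Nat.card_Ioc]
    congr 2 <;> omega
  rw [← hcard]
  have hB : ∀ B ⊆ Finset.Ioc (n - t - k) (n - t), B ⊆ Finset.Icc 1 (n - t) := by
    intro B hB x hx
    have := Finset.mem_Ioc.1 (hB hx)
    rw [Finset.mem_Icc]; omega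
  refine Finset.card_le_card_of_injOn (fun p => p.2 ∪ {p.1}) ?_ ?_
  · rintro ⟨y, B⟩ hp
    obtain ⟨hy, hB'⟩ := Finset.mem_product.1 hp
    obtain ⟨hB1, hB2⟩ := Finset.mem_powersetCard.1 hB'
    dsimp only at hy hB1 hB2 ⊢
    have hyT : {y} ⊆ Finset.Ioc (n - t) n := Finset.singleton_subset_iff.2 hy
    refine Finset.mem_coe.2 (Finset.mem_sdiff.2
      ⟨Finset.mem_powerset.2 (union_subset_Icc (hB B hB1) hyT), fun hmem => hnot ?_⟩)
    have hyB : y ∉ B := fun h => by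
      have h1 := Finset.mem_Ioc.1 (hB1 h)
      have h2 := Finset.mem_Ioc.1 hy
      omega
    obtain ⟨e⟩ : Nonempty (B ≃ A) := Fintype.card_eq.1 (by simp [hB2, hAc])
    refine hG _ hmem _ hAu (fun x => if h : x ∈ B then e ⟨x, h⟩ else u) ?_ ?_
    · intro x hx z hz hxz
      simp only [Finset.coe_union, Finset.coe_singleton, Set.mem_union, Finset.mem_coe,
        Set.mem_singleton_iff] at hx hz
      by_cases hxB : x ∈ B <;> by_cases hzB : z ∈ B
      · simp only [hxB, hzB, dif_pos] at hxz
        exact congrArg Subtype.val (e.injective (Subtype.ext hxz))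
      · simp only [hxB, hzB, dif_pos, dif_neg, not_false_iff] at hxz
        exact absurd (hxz ▸ (e ⟨x, hxB⟩).2) huA
      · simp only [hxB, hzB, dif_pos, dif_neg, not_false_iff] at hxz
        exact absurd (hxz ▸ (e ⟨z, hzB⟩).2) huA
      · rw [hx.resolve_left hxB, hz.resolve_left hzB]
    · intro x hx
      by_cases hxB : x ∈ B
      · simp only [hxB, dif_pos]
        refine ⟨Finset.mem_insert_of_mem (e ⟨x, hxB⟩).2, ?_⟩
        have h1 := Finset.mem_Icc.1 (hA (e ⟨x, hxB⟩).2)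
        have h2 := Finset.mem_Ioc.1 (hB1 hxB)
        omega
      · simp only [hxB, dif_neg, not_false_iff]
        have hxy : x = y := Finset.mem_singleton.1 ((Finset.mem_union.1 hx).resolve_left hxB)
        refine ⟨Finset.mem_insert_self _ _, ?_⟩
        have h1 := Finset.mem_Icc.1 hu
        have h2 := Finset.mem_Ioc.1 hy
        omega
  · rintro ⟨y, B⟩ hp ⟨y', B'⟩ hp' h
    obtain ⟨hy, hB1⟩ := Finset.mem_product.1 hp
    obtain ⟨hy', hB1'⟩ := Finset.mem_product.1 hp'
    have hB2 := hB B (Finset.mem_powersetCard.1 hB1).1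
    have hB2' := hB B' (Finset.mem_powersetCard.1 hB1').1
    dsimp only at hy hy' h
    have hyT : {y} ⊆ Finset.Ioc (n - t) n := Finset.singleton_subset_iff.2 hy
    have hyT' : {y'} ⊆ Finset.Ioc (n - t) n := Finset.singleton_subset_iff.2 hy'
    have e1 : B = B' := by
      rw [← inter_head hB2 hyT, ← inter_head hB2' hyT', h]
    have e2 : ({y} : Finset ℕ) = {y'} := by
      rw [← inter_tail hB2 hyT, ← inter_tail hB2' hyT', h]
    rw [e1, Finset.singleton_inj.1 e2]

/-- A large subset of `[n - t]` contains many disjoint `(b + 1)`-sets belonging to `G`. -/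
theorem exists_disjoint_blocks {n t b k : ℕ} {G : Finset (Finset ℕ)}
    (hG : DominationClosed n G) (htk : t + k ≤ n)
    (hlt : (missingSets n G).card < t * k.choose b) {V : Finset ℕ}
    (hV : V ⊆ Finset.Icc 1 (n - t)) {r : ℕ} (hr : k ≤ r) (hVr : (b + 1) * r ≤ V.card) :
    ∃ g : Fin r → Finset ℕ, (∀ i, g i ⊆ V ∧ g i ∈ G) ∧
      Pairwise fun i j => Disjoint (g i) (g j) := by
  classical
  -- At most `k ≤ r` elements of `V` are too large to be non-maximal in a block, so `b * r` small
  -- ones remain; the leftover elements serve as the `u i`.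
  have h1 : V.card ≤ (V.filter (· ≤ n - t - k)).card + k := by
    rw [← Finset.card_filter_add_card_filter_not (s := V) (· ≤ n - t - k)]
    have : V.filter (fun x => ¬ x ≤ n - t - k) ⊆ Finset.Ioc (n - t - k) (n - t) := by
      intro x hx
      obtain ⟨hx1, hx2⟩ := Finset.mem_filter.1 hx
      have := Finset.mem_Icc.1 (hV hx1)
      rw [Finset.mem_Ioc]; omega
    have := Finset.card_le_card this
    rw [Nat.card_Ioc] at this
    omega
  obtain ⟨L, hL, hLc⟩ := Finset.exists_subset_card_eq (s := V.filter (· ≤ n - t - k))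
    (n := r * b) (by nlinarith)
  have hLV : L ⊆ V := hL.trans (Finset.filter_subset _ _)
  obtain ⟨g, hg, hgd⟩ := exists_disjoint_subsets L r b hLc.ge
  obtain ⟨g', hg', hgd'⟩ := exists_disjoint_subsets (V \ L) r 1 (by
    rw [Finset.card_sdiff_of_subset hLV, hLc]
    have : (b + 1) * r = r * b + r * 1 := by ring
    omega)
  choose u hu using fun i => Finset.card_eq_one.1 (hg' i).2
  have huVL : ∀ i, u i ∈ V \ L := fun i => (hg' i).1 (by rw [hu i]; exact Finset.mem_singleton_self _)
  refine ⟨fun i => insert (u i) (g i), fun i => ⟨?_, ?_⟩, ?_⟩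
  · exact Finset.insert_subset (Finset.mem_sdiff.1 (huVL i)).1 ((hg i).1.trans hLV)
  · refine mem_of_card_missingSets_lt hG htk hlt ?_ (hg i).2
      (hV (Finset.mem_sdiff.1 (huVL i)).1) fun h => (Finset.mem_sdiff.1 (huVL i)).2 ((hg i).1 h)
    intro x hx
    have h2 := Finset.mem_filter.1 (hL ((hg i).1 hx))
    have h3 := Finset.mem_Icc.1 (hV h2.1)
    rw [Finset.mem_Icc]; omega
  · intro i j hij
    have e1 := hgd hij
    have e2 := hgd' hij
    simp only [hu] at e2
    rw [Finset.disjoint_insert_left, Finset.disjoint_insert_right, Finset.mem_insert]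
    refine ⟨fun h => ?_, fun h => (Finset.mem_sdiff.1 (huVL j)).2 ((hg i).1 h), e1⟩
    rcases h with h | h
    · exact Finset.disjoint_singleton.1 e2 h
    · exact (Finset.mem_sdiff.1 (huVL i)).2 ((hg j).1 h)

/-- Disjoint rich sets extend to many disjoint members of `G`, all avoiding a given set `D`. -/
theorem exists_disjoint_members {ι : Type*} [Fintype ι] {n t b k R : ℕ} {G : Finset (Finset ℕ)}
    (hG : DominationClosed n G) (htk : t + k ≤ n)
    (hlt : (missingSets n G).card < t * k.choose b) (J : ι → Finset ℕ)
    (hJT : ∀ i, J i ⊆ Finset.Ioc (n - t) n) (hJ : ∀ i, IsRich n t b R G (J i))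
    (hJd : Pairwise fun i j => Disjoint (J i) (J j)) {D : Finset ℕ}
    (hJD : ∀ i, Disjoint (J i) D) (hR : D.card + Fintype.card ι * b ≤ R) {s : ℕ}
    (hs : k + Fintype.card ι ≤ s)
    (hcard : (b + 1) * s ≤ (Finset.Icc 1 (n - t) \ D).card + Fintype.card ι) :
    ∃ g : Fin s → Finset ℕ, (∀ i, g i ∈ G ∧ Disjoint (g i) D) ∧
      Pairwise fun i j => Disjoint (g i) (g j) := by
  classical
  obtain ⟨A, hA, hAd⟩ := exists_disjoint_choice
    (fun i A => A ⊆ Finset.Icc 1 (n - t) ∧ A ∪ J i ∈ G) b R (fun i X hX => by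
      obtain ⟨A, h1, h2, h3, h4⟩ := hJ i X hX
      exact ⟨A, ⟨h1, h4⟩, h2, h3⟩) D hR
  set V := (Finset.Icc 1 (n - t) \ D) \ Finset.univ.biUnion A with hVdef
  have hVc : (Finset.Icc 1 (n - t) \ D).card ≤ V.card + Fintype.card ι * b := by
    have e1 : (Finset.univ.biUnion A).card ≤ Fintype.card ι * b :=
      Finset.card_biUnion_le_card_mul _ _ _ fun i _ => (hA i).2.1.le
    have e2 := Finset.le_card_sdiff (Finset.univ.biUnion A) (Finset.Icc 1 (n - t) \ D)
    rw [← hVdef] at e2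
    omega
  have hVD : V ⊆ Finset.Icc 1 (n - t) \ D := Finset.sdiff_subset
  obtain ⟨r, rfl⟩ : ∃ r, s = r + Fintype.card ι := ⟨s - Fintype.card ι, by omega⟩
  -- The sets `A i` use `b` head elements each, so at least `(b + 1) * (s - |ι|)` remain for the
  -- other `r = s - |ι|` members.
  obtain ⟨B, hB, hBd⟩ := exists_disjoint_blocks hG htk hlt (hVD.trans Finset.sdiff_subset)
    (r := r) (by omega) (by nlinarith)
  have hBA : ∀ i j, Disjoint (B i) (A j) := by
    intro i j
    refine (Finset.sdiff_disjoint (s := Finset.univ.biUnion A)).mono (hB i).1 ?_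
    exact Finset.subset_biUnion_of_mem A (Finset.mem_univ j)
  have hBh : ∀ i, B i ⊆ Finset.Icc 1 (n - t) := fun i =>
    (hB i).1.trans (hVD.trans Finset.sdiff_subset)
  have hBA' : ∀ i j, Disjoint (B i) (A j ∪ J j) := fun i j =>
    Finset.disjoint_union_right.2 ⟨hBA i j, disjoint_head_tail (hBh i) (hJT j)⟩
  let h : Fin r ⊕ ι → Finset ℕ := Sum.elim B fun i => A i ∪ J i
  obtain ⟨e⟩ : Nonempty (Fin (r + Fintype.card ι) ≃ Fin r ⊕ ι) :=
    Fintype.card_eq.1 (by simp)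
  have hmem : ∀ x, h x ∈ G ∧ Disjoint (h x) D := by
    rintro (a | a)
    · exact ⟨(hB a).2, Finset.sdiff_disjoint.mono_left ((hB a).1.trans hVD)⟩
    · exact ⟨(hA a).1.2, Finset.disjoint_union_left.2 ⟨(hA a).2.2, hJD a⟩⟩
  refine ⟨fun i => h (e i), fun i => hmem (e i), fun i j hij => ?_⟩
  · have hne : e i ≠ e j := fun h => hij (e.injective h)
    dsimp only
    generalize e i = x at hne
    generalize e j = y at hne
    rcases x with a | a <;> rcases y with a' | a'
    · exact hBd fun h => hne (by rw [h])
    · exact hBA' a a'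
    · exact (hBA' a' a).symm
    · have hne' : a ≠ a' := fun h => hne (by rw [h])
      exact Finset.disjoint_union_left.2 ⟨Finset.disjoint_union_right.2
        ⟨hAd hne', disjoint_head_tail (hA a).1.1 (hJT a')⟩, Finset.disjoint_union_right.2
        ⟨(disjoint_head_tail (hA a').1.1 (hJT a)).symm, hJd hne'⟩⟩

/-! ### The possible patterns of rich sets -/

/-- If few sets are poor and the rich sets contain no `t - c` disjoint ones, then the rich sets are
as in the family `Q`, or `c = 1` and they are as in the family `W`. -/
theorem rich_dichotomy {n t b R c : ℕ} {G : Finset (Finset ℕ)} (hG : DominationClosed n G)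
    (hc : 1 ≤ c) (ht : 2 * c + 3 ≤ t) (htn : t ≤ n)
    (hpoor : (poorSets n t b R G).card ≤ 2 * c + 2)
    (hno : ∀ J : Fin (t - c) → Finset ℕ, (∀ i, J i ⊆ Finset.Ioc (n - t) n) →
      (∀ i, IsRich n t b R G (J i)) → ¬ Pairwise fun i j => Disjoint (J i) (J j)) :
    ((∀ x ∈ Finset.Ioc (n - t) n, x ≤ n - (2 * c + 1) → IsRich n t b R G {x}) ∧
      ∀ J ⊆ Finset.Ioc (n - t) n, J.card = 2 → IsRich n t b R G J) ∨
    (c = 1 ∧ ∀ x ∈ Finset.Ioc (n - t) n, x ≤ n - 2 → IsRich n t b R G {x}) := by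
  classical
  have hempty : ¬ IsRich n t b R G ∅ := fun h =>
    hno (fun _ => ∅) (fun _ => Finset.empty_subset _) (fun _ => h)
      fun _ _ _ => Finset.disjoint_empty_left _
  have hmono : ∀ x ∈ Finset.Ioc (n - t) n, ∀ y ∈ Finset.Ioc (n - t) n, y ≤ x →
      IsRich n t b R G {x} → IsRich n t b R G {y} := by
    intro x hx y hy hyx h
    exact h.dominated hG (Finset.singleton_subset_iff.2 hx) (Finset.singleton_subset_iff.2 hy)
      (fun _ => y) (by simp) (by simpa using hyx)
  have hex : ∃ p, ∀ x ∈ Finset.Ioc (n - t) n, x ≤ n - p → IsRich n t b R G {x} :=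
    ⟨t, fun x hx hxt => by have := Finset.mem_Ioc.1 hx; omega⟩
  -- By monotonicity the poor singletons are exactly those of the last `p` elements.
  obtain ⟨p, hp, hpt, hmax⟩ : ∃ p, (∀ x ∈ Finset.Ioc (n - t) n, x ≤ n - p → IsRich n t b R G {x}) ∧
      p ≤ t ∧ ∀ x ∈ Finset.Ioc (n - t) n, n - p < x → ¬ IsRich n t b R G {x} := by
    refine ⟨Nat.find hex, Nat.find_spec hex, Nat.find_min' hex fun x hx hxt => ?_, ?_⟩
    · have := Finset.mem_Ioc.1 hx; omega
    · intro x hx hpx hr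
      have hx' := Finset.mem_Ioc.1 hx
      refine Nat.find_min hex (m := Nat.find hex - 1) (by omega) fun y hy hyp => ?_
      exact hmono x hx y hy (by omega) hr
  have hsub : Finset.Ioc (n - p) n ⊆ Finset.Ioc (n - t) n :=
    Finset.Ioc_subset_Ioc_left (by omega)
  -- The `t - p` rich singletons help, so the last `p` elements cannot contain `p - c` disjoint rich
  -- sets.
  have hcomb : ∀ q, ∀ J : Fin q → Finset ℕ, t - c ≤ q + (t - p) →
      (∀ i, J i ⊆ Finset.Ioc (n - p) n) → (∀ i, IsRich n t b R G (J i)) →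
      ¬ Pairwise fun i j => Disjoint (J i) (J j) := by
    intro q J hq hJ hJr hJd
    have hx : ∀ i : Fin (t - c), ¬ (i : ℕ) < q →
        n - t < n - t + 1 + (i - q) ∧ n - t + 1 + (i - q) ≤ n - p := by
      intro i hi
      have := i.2
      omega
    refine hno (fun i => if h : (i : ℕ) < q then J ⟨i, h⟩ else {n - t + 1 + (i - q)}) ?_ ?_ ?_
    · intro i
      by_cases h : (i : ℕ) < q
      · simp only [h, dif_pos]; exact (hJ _).trans hsub
      · simp only [h, dif_neg, not_false_iff, Finset.singleton_subset_iff]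
        have := hx i h
        exact Finset.mem_Ioc.2 (by omega)
    · intro i
      by_cases h : (i : ℕ) < q
      · simp only [h, dif_pos]; exact hJr _
      · simp only [h, dif_neg, not_false_iff]
        have := hx i h
        exact hp _ (Finset.mem_Ioc.2 (by omega)) this.2
    · intro i j hij
      have hij' : (i : ℕ) ≠ j := fun h => hij (Fin.ext h)
      have hlow : ∀ a ≤ n - p, ∀ l, a ∉ J l := by
        intro a ha l hal
        have := Finset.mem_Ioc.1 (hJ l hal)
        omega
      by_cases h : (i : ℕ) < q <;> by_cases h' : (j : ℕ) < q
      · rw [dif_pos h, dif_pos h']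
        exact hJd fun e => hij' (Fin.mk.inj e)
      · rw [dif_pos h, dif_neg h', Finset.disjoint_singleton_right]
        exact hlow _ (hx j h').2 _
      · rw [dif_neg h, dif_pos h', Finset.disjoint_singleton_left]
        exact hlow _ (hx i h).2 _
      · rw [dif_neg h, dif_neg h', Finset.disjoint_singleton]
        omega
  have hcount : ∀ E ⊆ poorSets n t b R G, (∀ J ∈ E, J.card = 2) → 1 + p + E.card ≤ 2 * c + 2 := by
    intro E hE hE2
    refine le_trans ?_ hpoor
    have hd1 : Disjoint ((Finset.Ioc (n - p) n).image fun x => ({x} : Finset ℕ)) E := by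
      refine Finset.disjoint_left.2 fun J hJ hJE => ?_
      obtain ⟨x, -, rfl⟩ := Finset.mem_image.1 hJ
      simpa using hE2 _ hJE
    have hd2 : ∅ ∉ ((Finset.Ioc (n - p) n).image fun x => ({x} : Finset ℕ)) ∪ E := by
      intro h
      rcases Finset.mem_union.1 h with h | h
      · obtain ⟨x, -, h⟩ := Finset.mem_image.1 h
        exact Finset.singleton_ne_empty x h
      · simpa using hE2 _ h
    have hcard : (insert ∅ (((Finset.Ioc (n - p) n).image fun x => ({x} : Finset ℕ)) ∪ E)).card
        = 1 + p + E.card := by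
      rw [Finset.card_insert_of_notMem hd2, Finset.card_union_of_disjoint hd1,
        Finset.card_image_of_injective _ Finset.singleton_injective, Nat.card_Ioc]
      omega
    rw [← hcard]
    refine Finset.card_le_card (Finset.insert_subset ?_ (Finset.union_subset ?_ hE))
    · exact mem_poorSets.2 ⟨Finset.empty_subset _, hempty⟩
    · intro J hJ
      obtain ⟨x, hx, rfl⟩ := Finset.mem_image.1 hJ
      exact mem_poorSets.2 ⟨Finset.singleton_subset_iff.2 (hsub hx),
        hmax x (hsub hx) (Finset.mem_Ioc.1 hx).1⟩
  have hp_le : p ≤ 2 * c + 1 := by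
    have := hcount ∅ (Finset.empty_subset _) (by simp)
    simp at this
    omega
  have hcp : c < p := by
    by_contra! h
    exact hcomb 0 (fun _ => ∅) (by omega) (fun i => i.elim0) (fun i => i.elim0) (fun i => i.elim0)
  rcases Nat.lt_or_ge (c + 1) p with hcp1 | hcp1
  · rcases Nat.lt_or_ge p (2 * c + 1) with hp2 | hp2
    · exfalso
      -- As `p ≤ 2c`, there is room for `q = p - c` nested pairs in the last `p` elements. One of
      -- them is poor, and then so are the `c` pairs `{a, n}` it dominates; with `∅` and the `p`
      -- singletons this exceeds `2c + 2`.
      obtain ⟨q, rfl⟩ : ∃ q, p = c + q := ⟨p - c, by omega⟩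
      have hpair : ∀ i : Fin q, n - (c + q) + 1 + i < n - (c + q) + 2 * q - i := by
        intro i; have := i.2; omega
      have hJ : ∀ i : Fin q,
          ({n - (c + q) + 1 + (i : ℕ), n - (c + q) + 2 * q - i} : Finset ℕ) ⊆
            Finset.Ioc (n - (c + q)) n := by
        intro i x hx
        have := i.2
        simp only [Finset.mem_insert, Finset.mem_singleton] at hx
        rw [Finset.mem_Ioc]
        omega
      obtain ⟨i, hi⟩ : ∃ i : Fin q, ¬ IsRich n t b R G
          {n - (c + q) + 1 + (i : ℕ), n - (c + q) + 2 * q - i} := by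
        by_contra! hall
        refine hcomb q _ (by omega) hJ hall ?_
        intro i j hij
        have hij' : (i : ℕ) ≠ j := fun h => hij (Fin.ext h)
        have := i.2
        have := j.2
        simp only [Finset.disjoint_insert_left, Finset.disjoint_singleton_left,
          Finset.mem_insert, Finset.mem_singleton]
        omega
      have := i.2
      have hcardE : ((Finset.Ico (n - (c + q) + q) n).image fun a => ({a, n} : Finset ℕ)).card
          = c := by
        rw [Finset.card_image_of_injOn, Nat.card_Ico]
        · omega
        · intro a ha a' ha' h
          have h1 : a ∈ ({a', n} : Finset ℕ) := by
            rw [← show ({a, n} : Finset ℕ) = {a', n} from h]; simp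
          have h2 := Finset.mem_Ico.1 ha
          simp only [Finset.mem_insert, Finset.mem_singleton] at h1
          omega
      have := hcount ((Finset.Ico (n - (c + q) + q) n).image fun a => ({a, n} : Finset ℕ)) ?_ ?_
      · omega
      · intro J hJE
        obtain ⟨a, ha, rfl⟩ := Finset.mem_image.1 hJE
        have ha' := Finset.mem_Ico.1 ha
        have haT : ({a, n} : Finset ℕ) ⊆ Finset.Ioc (n - t) n := by
          intro x hx
          simp only [Finset.mem_insert, Finset.mem_singleton] at hx
          rw [Finset.mem_Ioc]
          omega
        refine mem_poorSets.2 ⟨haT, fun hr => hi ?_⟩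
        have hlt := hpair i
        refine hr.dominated hG haT ((hJ i).trans hsub)
          (fun x => if x = n then n - (c + q) + 2 * q - i else n - (c + q) + 1 + i) ?_ ?_
        · intro x hx y hy hxy
          simp only [Finset.coe_insert, Finset.coe_singleton, Set.mem_insert_iff,
            Set.mem_singleton_iff] at hx hy
          dsimp only at hxy
          split_ifs at hxy <;> omega
        · intro x hx
          simp only [Finset.mem_insert, Finset.mem_singleton] at hx
          split_ifs with h
          · simp only [Finset.mem_insert, Finset.mem_singleton, or_true, true_and]; omega
          · simp only [Finset.mem_insert, Finset.mem_singleton, true_or, true_and]; omega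
      · intro J hJE
        obtain ⟨a, ha, rfl⟩ := Finset.mem_image.1 hJE
        exact Finset.card_pair (Finset.mem_Ico.1 ha).2.ne
    · left
      -- Now `∅` and the singletons already account for all `2c + 2` poor sets, so no pair is poor.
      obtain rfl : p = 2 * c + 1 := by omega
      refine ⟨hp, fun J hJ hJ2 => ?_⟩
      by_contra hr
      have := hcount {J} (Finset.singleton_subset_iff.2 (mem_poorSets.2 ⟨hJ, hr⟩)) (by simpa)
      simp at this
  · right
    obtain rfl : p = c + 1 := by omega
    -- One rich set inside the last `c + 1` elements would be too many, so all `2 ^ (c + 1)` subsets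
    -- are poor; this is at most `2c + 2` only for `c = 1`.
    have hall : (Finset.Ioc (n - (c + 1)) n).powerset ⊆ poorSets n t b R G := by
      intro J hJ
      have hJ' := Finset.mem_powerset.1 hJ
      refine mem_poorSets.2 ⟨hJ'.trans hsub, fun hr => ?_⟩
      exact hcomb 1 (fun _ => J) (by omega) (fun _ => hJ') (fun _ => hr)
        fun i j hij => absurd (Subsingleton.elim i j) hij
    have h1 := (Finset.card_le_card hall).trans hpoor
    rw [Finset.card_powerset, Nat.card_Ioc, Nat.sub_sub_self (by omega), pow_succ] at h1
    obtain rfl : c = 1 := by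
      by_contra hc1
      obtain ⟨d, rfl⟩ : ∃ d, c = d + 2 := ⟨c - 2, by omega⟩
      have := Nat.lt_two_pow_self (n := d)
      rw [pow_add] at h1
      omega
    exact ⟨rfl, hp⟩

/-! ### Contradiction from a set outside `Q` or `W` -/

/-- Rich singletons off the last `p` elements, together with `q` disjoint rich sets inside the
last `p` elements, extend to many disjoint members of `G` avoiding `D`. -/
theorem exists_disjoint_members_of_singletons {n t b k R p q s : ℕ} {G : Finset (Finset ℕ)}
    (hG : DominationClosed n G) (htk : t + k ≤ n)
    (hlt : (missingSets n G).card < t * k.choose b) (hpt : p ≤ t) (hqp : q ≤ p)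
    (hsing : ∀ x ∈ Finset.Ioc (n - t) n, x ≤ n - p → IsRich n t b R G {x})
    (J : Fin q → Finset ℕ) (hJp : ∀ i, J i ⊆ Finset.Ioc (n - p) n)
    (hJ : ∀ i, IsRich n t b R G (J i)) (hJd : Pairwise fun i j => Disjoint (J i) (J j))
    {D : Finset ℕ} (hJD : ∀ i, Disjoint (J i) D) (hR : D.card + t * b ≤ R) (hs : k + t ≤ s)
    (hcard : (b + 1) * s ≤ (Finset.Icc 1 (n - p) \ D).card + q) :
    ∃ g : Fin s → Finset ℕ, (∀ i, g i ∈ G ∧ Disjoint (g i) D) ∧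
      Pairwise fun i j => Disjoint (g i) (g j) := by
  classical
  set S := Finset.Ioc (n - t) (n - p) \ D with hSdef
  have hS : ∀ x ∈ S, (n - t < x ∧ x ≤ n - p) ∧ x ∉ D := by
    intro x hx
    rw [hSdef, Finset.mem_sdiff, Finset.mem_Ioc] at hx
    exact hx
  have hSc : S.card ≤ t - p := by
    refine (Finset.card_le_card Finset.sdiff_subset).trans ?_
    rw [Nat.card_Ioc]; omega
  have hι : Fintype.card ({x // x ∈ S} ⊕ Fin q) = S.card + q := by simp
  -- A rich singleton saves its member one head element, so the points of `S` count like head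
  -- elements.
  have hsplit : (Finset.Icc 1 (n - p) \ D).card ≤ (Finset.Icc 1 (n - t) \ D).card + S.card := by
    refine (Finset.card_le_card ?_).trans (Finset.card_union_le _ _)
    intro x hx
    rw [Finset.mem_sdiff, Finset.mem_Icc] at hx
    rw [Finset.mem_union, hSdef, Finset.mem_sdiff, Finset.mem_sdiff, Finset.mem_Icc, Finset.mem_Ioc]
    by_cases h : x ≤ n - t
    · exact Or.inl ⟨⟨hx.1.1, h⟩, hx.2⟩
    · exact Or.inr ⟨⟨by omega, hx.1.2⟩, hx.2⟩
  have hlow : ∀ x ∈ S, ∀ i, x ∉ J i := fun x hx i hi => by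
    have h1 := Finset.mem_Ioc.1 (hJp i hi)
    have h2 := hS x hx
    omega
  refine exists_disjoint_members hG htk hlt
    (Sum.elim (fun x : {x // x ∈ S} => ({x.1} : Finset ℕ)) J) ?_ ?_ ?_ ?_ (R := R) ?_ ?_ ?_
  · rintro (x | i)
    · refine Finset.singleton_subset_iff.2 (Finset.mem_Ioc.2 ?_)
      have := hS x.1 x.2
      omega
    · exact (hJp i).trans (Finset.Ioc_subset_Ioc_left (by omega))
  · rintro (x | i)
    · have := hS x.1 x.2
      exact hsing x.1 (Finset.mem_Ioc.2 (by omega)) this.1.2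
    · exact hJ i
  · rintro (x | i) (y | j) hne
    · exact Finset.disjoint_singleton.2 fun h => hne (congrArg Sum.inl (Subtype.ext h))
    · exact Finset.disjoint_singleton_left.2 (hlow x.1 x.2 j)
    · exact Finset.disjoint_singleton_right.2 (hlow y.1 y.2 i)
    · exact hJd fun h => hne (congrArg Sum.inr h)
  · rintro (x | i)
    · exact Finset.disjoint_singleton_left.2 (hS x.1 x.2).2
    · exact hJD i
  · rw [hι]
    have : (S.card + q) * b ≤ t * b := Nat.mul_le_mul_right _ (by omega)
    omega
  · rw [hι]; omega
  · rw [hι]; omega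

/-- A shifted family without `s` disjoint members that is contained in neither `Q` nor `W` either
has many poor sets or misses very many sets. -/
theorem poorSets_card_of_shifted {m c s t k R : ℕ} (hm : 1 ≤ m) (hc : 1 ≤ c) (ht : 2 * c + 3 ≤ t)
    (hks : k + t + 1 ≤ s) (hR : 2 * m + t * m ≤ R) {F : Finset (Finset ℕ)}
    (hFn : F ⊆ (Finset.Icc 1 (m * s + c)).powerset) (hF : IsShifted (m * s + c) F)
    (hν : matchingNumber F < s) (hQ : ¬ F ⊆ familyQ m s c) (hW : c = 1 → ¬ F ⊆ familyW m s c)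
    (hlt : (missingSets (m * s + c) (upGenerated (m * s + c) F)).card < t * k.choose (m - 1)) :
    2 * c + 3 ≤ (poorSets (m * s + c) t (m - 1) R (upGenerated (m * s + c) F)).card := by
  classical
  by_contra! hpoor
  obtain ⟨b, rfl⟩ : ∃ b, m = b + 1 := ⟨m - 1, by omega⟩
  rw [Nat.add_sub_cancel] at hlt hpoor
  have hG := dominationClosed_upGenerated hF
  have hsn : s ≤ (b + 1) * s := Nat.le_mul_of_pos_left _ (by omega)
  set n := (b + 1) * s + c with hn
  have htb : t * (b + 1) = t * b + t := by ring
  have hs1 : (b + 1) * s = (b + 1) * (s - 1) + (b + 1) := by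
    obtain ⟨s', rfl⟩ : ∃ s', s = s' + 1 := ⟨s - 1, by omega⟩
    rw [Nat.add_sub_cancel]; ring
  have hD : ∀ D ∈ F, ¬ ∃ g : Fin (s - 1) → Finset ℕ,
      (∀ i, g i ∈ upGenerated n F ∧ Disjoint (g i) D) ∧
        Pairwise fun i j => Disjoint (g i) (g j) := by
    rintro D hDF ⟨g, hg, hgd⟩
    have := card_lt_matchingNumber_of_upGenerated g (fun i => (hg i).1) hgd hDF fun i => (hg i).2
    rw [Fintype.card_fin] at this
    omega
  have hsplit : ∀ D ∈ F, ∀ p ≤ n, (D ∩ Finset.Icc 1 (n - p)).card +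
      (Finset.Icc 1 (n - p) \ D).card = n - p ∧
      (D ∩ Finset.Icc 1 (n - p)).card + (D ∩ Finset.Ioc (n - p) n).card = D.card ∧
      (D ∩ Finset.Ioc (n - p) n).card + (Finset.Ioc (n - p) n \ D).card = p := by
    intro D hDF p hp
    have hDn := Finset.mem_powerset.1 (hFn hDF)
    refine ⟨?_, ?_, ?_⟩
    · rw [Finset.inter_comm, Finset.card_inter_add_card_sdiff, Nat.card_Icc, Nat.add_sub_cancel]
    · rw [← Finset.card_union_of_disjoint, ← Finset.inter_union_distrib_left]
      · congr 1
        refine Finset.inter_eq_left.2 fun x hx => ?_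
        have := Finset.mem_Icc.1 (hDn hx)
        rw [Finset.mem_union, Finset.mem_Icc, Finset.mem_Ioc]
        omega
      · exact (disjoint_head_tail subset_rfl subset_rfl).mono Finset.inter_subset_right
          Finset.inter_subset_right
    · rw [Finset.inter_comm, Finset.card_inter_add_card_sdiff, Nat.card_Ioc]
      omega
  have hno : ∀ J : Fin (t - c) → Finset ℕ, (∀ i, J i ⊆ Finset.Ioc (n - t) n) →
      (∀ i, IsRich n t b R (upGenerated n F) (J i)) →
      ¬ Pairwise fun i j => Disjoint (J i) (J j) := by
    intro J hJT hJ hJd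
    -- The count is exact: `(n - t) + (t - c) = m * s`.
    obtain ⟨g, hg, hgd⟩ := exists_disjoint_members (k := k) (D := ∅) (s := s) hG (by omega) hlt J
      hJT hJ hJd (fun _ => Finset.disjoint_empty_right _) (by
        rw [Finset.card_empty, Fintype.card_fin, zero_add]
        have : (t - c) * b ≤ t * b := Nat.mul_le_mul_right _ (by omega)
        omega) (by rw [Fintype.card_fin]; omega)
      (by rw [Finset.sdiff_empty, Nat.card_Icc, Fintype.card_fin]; omega)
    have := card_le_matchingNumber_of_upGenerated g (fun i => (hg i).1) hgd
    rw [Fintype.card_fin] at this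
    omega
  rcases rich_dichotomy (R := R) (b := b) hG hc ht (by omega) (by omega) hno with
    ⟨hsing, hpairs⟩ | ⟨rfl, hsing⟩
  · obtain ⟨D, hDF, hDQ⟩ := Finset.not_subset.1 hQ
    have hw : D.card + (D ∩ Finset.Icc 1 (n - (2 * c + 1))).card < 2 * (b + 1) := by
      by_contra! h
      refine hDQ (Finset.mem_filter.2 ⟨hFn hDF, ?_⟩)
      rwa [show (b + 1) * s - c - 1 = n - (2 * c + 1) by omega]
    obtain ⟨h1, h2, h3⟩ := hsplit D hDF (2 * c + 1) (by omega)
    -- Pair up what `D` leaves of the last `2c + 1` elements. If `D` has `e` elements before them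
    -- and `d` among them, `s - 1` members fit when `e + ⌈(d + 1) / 2⌉ ≤ m`, which is `2 * e + d < 2
    -- * m`.
    obtain ⟨J, hJ, hJd⟩ := exists_disjoint_subsets (Finset.Ioc (n - (2 * c + 1)) n \ D)
      ((2 * c + 1 - (D ∩ Finset.Ioc (n - (2 * c + 1)) n).card) / 2) 2 (by omega)
    have hJT : ∀ i, J i ⊆ Finset.Ioc (n - (2 * c + 1)) n := fun i =>
      (hJ i).1.trans Finset.sdiff_subset
    refine hD D hDF (exists_disjoint_members_of_singletons (k := k) (R := R) (p := 2 * c + 1) hG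
      (by omega) hlt (by omega) ?_ hsing J hJT (fun i => hpairs _ ?_ (hJ i).2) hJd
      (fun i => Finset.sdiff_disjoint.mono_left (hJ i).1) (by omega) (by omega) (by omega))
    · omega
    · exact (hJT i).trans (Finset.Ioc_subset_Ioc_left (by omega))
  · obtain ⟨D, hDF, hDW⟩ := Finset.not_subset.1 (hW rfl)
    have hw : (D ∩ Finset.Icc 1 (n - 2)).card < b + 1 := by
      by_contra! h
      refine hDW (Finset.mem_filter.2 ⟨hFn hDF, ?_⟩)
      rwa [show (b + 1) * s - 1 = n - 2 by omega]
    obtain ⟨h1, h2, h3⟩ := hsplit D hDF 2 (by omega)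
    exact hD D hDF (exists_disjoint_members_of_singletons (k := k) (R := R) (p := 2) (q := 0) hG
      (by omega) hlt (by omega) (by omega) hsing (fun _ => ∅) (fun i => i.elim0)
      (fun i => i.elim0) (fun i => i.elim0) (fun i => i.elim0) (by omega) (by omega) (by omega))

/-! ### Binomial estimates and the lower bound -/

theorem choose_succ_le_choose_sub_add (n d b : ℕ) :
    n.choose (b + 1) ≤ (n - d).choose (b + 1) + d * n ^ b := by
  induction d with
  | zero => simp
  | succ d ih =>
    refine ih.trans ?_
    rcases Nat.eq_zero_or_pos (n - d) with h | h
    · rw [h, show n - (d + 1) = 0 by omega, Nat.succ_mul]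
      omega
    · have h1 : n - d = n - (d + 1) + 1 := by omega
      have h2 := Nat.choose_succ_succ (n - (d + 1)) b
      have h3 : (n - (d + 1)).choose b ≤ n ^ b :=
        (Nat.choose_le_pow _ _).trans (Nat.pow_le_pow_left (by omega) _)
      rw [h1, Nat.succ_mul]
      simp only [Nat.succ_eq_add_one] at h2
      omega

theorem mul_add_le_mul {m c s : ℕ} (hs : 1 ≤ s) : m * s + c ≤ (m + c) * s := by
  nlinarith

/-- Both binomials are compared with powers: `n ^ b` above, `(k + 1 - b) ^ b` below, after
cancelling `b!`. -/
theorem choose_le_mul_choose {b a s k n : ℕ} (hn : n ≤ a * s) (hk : s ≤ 2 * (k + 1 - b)) :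
    n.choose b ≤ (2 * a) ^ b * k.choose b := by
  have h1 : n.choose b * b.factorial ≤ n ^ b := by
    rw [mul_comm, ← Nat.descFactorial_eq_factorial_mul_choose]
    exact Nat.descFactorial_le_pow n b
  have h2 : (k + 1 - b) ^ b ≤ b.factorial * k.choose b := by
    rw [← Nat.descFactorial_eq_factorial_mul_choose]
    exact Nat.pow_sub_le_descFactorial k b
  have h3 : n ^ b ≤ (2 * a) ^ b * (k + 1 - b) ^ b := by
    rw [← mul_pow]
    refine Nat.pow_le_pow_left (hn.trans ?_) b
    calc a * s ≤ a * (2 * (k + 1 - b)) := Nat.mul_le_mul_left _ hk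
      _ = 2 * a * (k + 1 - b) := by ring
  refine Nat.le_of_mul_le_mul_right ?_ (Nat.factorial_pos b)
  calc n.choose b * b.factorial ≤ (2 * a) ^ b * (k + 1 - b) ^ b := h1.trans h3
    _ ≤ (2 * a) ^ b * (b.factorial * k.choose b) := Nat.mul_le_mul_left _ h2
    _ = (2 * a) ^ b * k.choose b * b.factorial := by ring

theorem exists_mul_choose_le_card_missingSets (m c : ℕ) (hm : 2 ≤ m) (hc : 1 ≤ c) :
    ∃ K : ℕ, ∀ s : ℕ, c ≤ s → ∀ F : Finset (Finset ℕ),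
      F ⊆ (Finset.Icc 1 (m * s + c)).powerset → IsShifted (m * s + c) F →
      matchingNumber F < s → ¬ F ⊆ familyQ m s c → (c = 1 → ¬ F ⊆ familyW m s c) →
      (2 * c + 3) * (m * s + c).choose (m - 1) ≤
        (missingSets (m * s + c) F).card + K * s ^ (m - 2) := by
  -- From here `b = m - 2`, so the completing sets have `b + 1` elements.
  obtain ⟨b, rfl⟩ : ∃ b, m = b + 2 := ⟨m - 2, by omega⟩
  rw [show b + 2 - 1 = b + 1 by omega, Nat.add_sub_cancel]
  -- The first summand makes `t * k.choose (m - 1)`, with `k = s - t - 1`, at least `(2c + 3) *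
  -- n.choose (m - 1)`; the second gives `2c + 3 ≤ t` and room for the lost `∅`.
  obtain ⟨t, ht⟩ : ∃ t, t = (2 * c + 3) * (2 * (b + 2 + c)) ^ (b + 1) + (2 * c + 3) := ⟨_, rfl⟩
  obtain ⟨R, hR⟩ : ∃ R, R = 2 * (b + 2) + t * (b + 2) := ⟨_, rfl⟩
  obtain ⟨s₀, hs₀⟩ : ∃ s₀, s₀ = 2 * (t + b + 2) := ⟨_, rfl⟩
  -- The terms pay for the lost `∅`, for shrinking `n` to `n - t - R`, and for all `s < s₀`.
  refine ⟨1 + (2 * c + 3) * ((t + R) * (b + 2 + c) ^ b) +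
    (2 * c + 3) * ((b + 2) * s₀ + c).choose (b + 1), ?_⟩
  intro s hcs F hFn hF hν hQ hW
  have hspos : 1 ≤ s ^ b := Nat.one_le_pow _ _ (by omega)
  rcases Nat.lt_or_ge s s₀ with hs | hs
  · have h1 : ((b + 2) * s + c).choose (b + 1) ≤ ((b + 2) * s₀ + c).choose (b + 1) :=
      Nat.choose_le_choose _ (Nat.add_le_add_right (Nat.mul_le_mul_left _ hs.le) _)
    refine (Nat.mul_le_mul_left (2 * c + 3) h1).trans (le_trans ?_ (Nat.le_add_left _ _))
    exact (Nat.le_mul_of_pos_right _ hspos).trans (Nat.mul_le_mul_right _ (Nat.le_add_left _ _))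
  · by_contra! hlt
    have hup := card_missingSets_upGenerated_le ((b + 2) * s + c) F
    have hk1 : ((b + 2) * s + c).choose (b + 1) ≤
        (2 * (b + 2 + c)) ^ (b + 1) * (s - t - 1).choose (b + 1) :=
      choose_le_mul_choose (s := s) (mul_add_le_mul (by omega)) (by omega)
    have hk2 : 0 < (s - t - 1).choose (b + 1) := Nat.choose_pos (by omega)
    have hmiss : (missingSets ((b + 2) * s + c) (upGenerated ((b + 2) * s + c) F)).card <
        t * (s - t - 1).choose (b + 1) := by
      have h1 := Nat.mul_le_mul_left (2 * c + 3) hk1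
      have h2 : t * (s - t - 1).choose (b + 1) = (2 * c + 3) *
          ((2 * (b + 2 + c)) ^ (b + 1) * (s - t - 1).choose (b + 1)) +
            (2 * c + 3) * (s - t - 1).choose (b + 1) := by
        generalize (s - t - 1).choose (b + 1) = a
        rw [ht]; ring
      have h3 : 0 < (2 * c + 3) * (s - t - 1).choose (b + 1) := Nat.mul_pos (by omega) hk2
      have h4 : 0 < (1 + (2 * c + 3) * ((t + R) * (b + 2 + c) ^ b) +
          (2 * c + 3) * ((b + 2) * s₀ + c).choose (b + 1)) * s ^ b :=
        Nat.mul_pos (by omega) hspos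
      omega
    have hpoor := poorSets_card_of_shifted (t := t) (k := s - t - 1) (R := R) (by omega) hc
      (by omega) (by omega) (by omega) hFn hF hν hQ hW hmiss
    rw [show b + 2 - 1 = b + 1 by omega] at hpoor
    have h1 := (Nat.mul_le_mul_right _ hpoor).trans
      (card_poorSets_mul_le ((b + 2) * s + c) t (b + 1) R (upGenerated ((b + 2) * s + c) F))
    have h2 := choose_succ_le_choose_sub_add ((b + 2) * s + c) (t + R) b
    rw [← Nat.sub_sub] at h2
    have h3 : ((b + 2) * s + c) ^ b ≤ (b + 2 + c) ^ b * s ^ b := by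
      rw [← mul_pow]
      exact Nat.pow_le_pow_left (mul_add_le_mul (by omega)) _
    have h4 := h2.trans (Nat.add_le_add_left (Nat.mul_le_mul_left (t + R) h3) _)
    have h5 := Nat.mul_le_mul_left (2 * c + 3) h4
    have h6 : 0 ≤ (2 * c + 3) * ((b + 2) * s₀ + c).choose (b + 1) * s ^ b := Nat.zero_le _
    nlinarith

/-! ### The size of the complement of `Q` -/

theorem card_powerset_filter_card_lt_le (U : Finset ℕ) (b : ℕ) :
    (U.powerset.filter fun A => A.card < b + 1).card ≤ (b + 1) * (U.card + 1) ^ b := by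
  have hsub : (U.powerset.filter fun A => A.card < b + 1) ⊆
      (Finset.range (b + 1)).biUnion fun j => U.powersetCard j := by
    intro A hA
    obtain ⟨h1, h2⟩ := Finset.mem_filter.1 hA
    exact Finset.mem_biUnion.2 ⟨A.card, Finset.mem_range.2 h2,
      Finset.mem_powersetCard.2 ⟨Finset.mem_powerset.1 h1, rfl⟩⟩
  refine (Finset.card_le_card hsub).trans ((Finset.card_biUnion_le_card_mul _ _ _ ?_).trans_eq
    (by rw [Finset.card_range]))
  intro j hj
  rw [Finset.card_powersetCard]
  calc U.card.choose j ≤ U.card ^ j := Nat.choose_le_pow _ _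
    _ ≤ (U.card + 1) ^ j := Nat.pow_le_pow_left (by omega) _
    _ ≤ (U.card + 1) ^ b := Nat.pow_le_pow_right (by omega)
      (Nat.lt_succ_iff.1 (Finset.mem_range.1 hj))

/-- The number of subsets of `[n]` of weight at most `2b + 1`, when the last `p` elements have
weight one and the others have weight two. -/
theorem card_light_sets_bounds {n p b : ℕ} (hpn : p ≤ n) (M : Finset (Finset ℕ))
    (hM : ∀ P, P ∈ M ↔ P ⊆ Finset.Icc 1 n ∧
      P.card + (P ∩ Finset.Icc 1 (n - p)).card < 2 * (b + 1)) :
    (p + 1) * (n - p).choose b ≤ M.card ∧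
      M.card ≤ (p + 1) * (n - p).choose b +
        ((Finset.Icc 1 (n - p)).powerset.filter fun A => A.card < b).card * 2 ^ p := by
  classical
  set S := insert ∅ ((Finset.Ioc (n - p) n).image fun x => ({x} : Finset ℕ)) with hS
  have hScard : S.card = p + 1 := by
    rw [hS, Finset.card_insert_of_notMem, Finset.card_image_of_injective _
      Finset.singleton_injective, Nat.card_Ioc, Nat.sub_sub_self hpn]
    intro h
    obtain ⟨x, -, h⟩ := Finset.mem_image.1 h
    exact Finset.singleton_ne_empty x h
  have hSmem : ∀ J, J ∈ S ↔ J ⊆ Finset.Ioc (n - p) n ∧ J.card ≤ 1 := by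
    intro J
    rw [hS, Finset.mem_insert, Finset.mem_image]
    constructor
    · rintro (rfl | ⟨x, hx, rfl⟩)
      · simp
      · exact ⟨Finset.singleton_subset_iff.2 hx, by simp⟩
    · rintro ⟨h1, h2⟩
      rcases Nat.le_one_iff_eq_zero_or_eq_one.1 h2 with h | h
      · exact Or.inl (Finset.card_eq_zero.1 h)
      · obtain ⟨x, rfl⟩ := Finset.card_eq_one.1 h
        exact Or.inr ⟨x, Finset.singleton_subset_iff.1 h1, rfl⟩
  have hprod : (S ×ˢ (Finset.Icc 1 (n - p)).powersetCard b).card = (p + 1) * (n - p).choose b := by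
    rw [Finset.card_product, hScard, Finset.card_powersetCard, Nat.card_Icc, Nat.add_sub_cancel]
  constructor
  · rw [← hprod]
    refine Finset.card_le_card_of_injOn (fun q => q.2 ∪ q.1) ?_ ?_
    · rintro ⟨J, A⟩ hq
      obtain ⟨hJ, hA⟩ := Finset.mem_product.1 hq
      obtain ⟨hJ1, hJ2⟩ := (hSmem J).1 hJ
      obtain ⟨hA1, hA2⟩ := Finset.mem_powersetCard.1 hA
      refine Finset.mem_coe.2 ((hM _).2 ⟨union_subset_Icc hA1 hJ1, ?_⟩)
      dsimp only at hJ1 hJ2 hA1 hA2 ⊢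
      have := Finset.card_union_le A J
      rw [inter_head hA1 hJ1]
      omega
    · rintro ⟨J, A⟩ hq ⟨J', A'⟩ hq' h
      obtain ⟨hJ, hA⟩ := Finset.mem_product.1 hq
      obtain ⟨hJ', hA'⟩ := Finset.mem_product.1 hq'
      have hJ1 := ((hSmem J).1 hJ).1
      have hJ1' := ((hSmem J').1 hJ').1
      have hA1 := (Finset.mem_powersetCard.1 hA).1
      have hA1' := (Finset.mem_powersetCard.1 hA').1
      dsimp only at hJ1 hJ1' hA1 hA1' h
      have e1 : A = A' := by rw [← inter_head hA1 hJ1, ← inter_head hA1' hJ1', h]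
      have e2 : J = J' := by rw [← inter_tail hA1 hJ1, ← inter_tail hA1' hJ1', h]
      rw [e1, e2]
  -- Weight below `2 * b + 2` allows at most `b` elements of weight two; with exactly `b` of them at
  -- most one further element fits. With fewer, any subset of the last `p` elements is admitted, at
  -- lower-order cost.
  · have hcover : M ⊆ (S ×ˢ (Finset.Icc 1 (n - p)).powersetCard b ∪
        (Finset.Ioc (n - p) n).powerset ×ˢ
          ((Finset.Icc 1 (n - p)).powerset.filter fun A => A.card < b)).image
            fun q => q.2 ∪ q.1 := by
      intro P hP
      obtain ⟨hP1, hP2⟩ := (hM P).1 hP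
      have hu : P ∩ Finset.Icc 1 (n - p) ∪ P ∩ Finset.Ioc (n - p) n = P := by
        rw [← Finset.inter_union_distrib_left]
        refine Finset.inter_eq_left.2 fun x hx => ?_
        have := Finset.mem_Icc.1 (hP1 hx)
        rw [Finset.mem_union, Finset.mem_Icc, Finset.mem_Ioc]
        omega
      have hc : (P ∩ Finset.Icc 1 (n - p)).card + (P ∩ Finset.Ioc (n - p) n).card = P.card := by
        rw [← Finset.card_union_of_disjoint, hu]
        exact (disjoint_head_tail subset_rfl subset_rfl).mono Finset.inter_subset_right
          Finset.inter_subset_right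
      refine Finset.mem_image.2 ⟨(P ∩ Finset.Ioc (n - p) n, P ∩ Finset.Icc 1 (n - p)), ?_, hu⟩
      rw [Finset.mem_union, Finset.mem_product, Finset.mem_product, hSmem,
        Finset.mem_powersetCard, Finset.mem_filter, Finset.mem_powerset, Finset.mem_powerset]
      have i1 : P ∩ Finset.Icc 1 (n - p) ⊆ Finset.Icc 1 (n - p) := Finset.inter_subset_right
      have i2 : P ∩ Finset.Ioc (n - p) n ⊆ Finset.Ioc (n - p) n := Finset.inter_subset_right
      rcases Nat.lt_or_ge (P ∩ Finset.Icc 1 (n - p)).card b with h | h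
      · exact Or.inr ⟨i2, i1, h⟩
      · exact Or.inl ⟨⟨i2, by dsimp only; omega⟩, i1, by dsimp only; omega⟩
    refine (Finset.card_le_card hcover).trans (Finset.card_image_le.trans
      ((Finset.card_union_le _ _).trans_eq ?_))
    rw [hprod, Finset.card_product, Finset.card_powerset, Nat.card_Ioc, Nat.sub_sub_self hpn,
      mul_comm (2 ^ p)]

theorem mem_missingSets_familyQ {m s c : ℕ} {P : Finset ℕ} :
    P ∈ missingSets (m * s + c) (familyQ m s c) ↔ P ⊆ Finset.Icc 1 (m * s + c) ∧
      P.card + (P ∩ Finset.Icc 1 (m * s + c - (2 * c + 1))).card < 2 * m := by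
  rw [missingSets, familyQ, Finset.mem_sdiff, Finset.mem_filter, Finset.mem_powerset,
    show m * s + c - (2 * c + 1) = m * s - c - 1 by omega]
  refine and_congr_right fun h => ?_
  rw [not_and, not_le]
  exact ⟨fun h' => h' h, fun h' _ => h'⟩

theorem exists_card_missingSets_familyQ_bounds (m c : ℕ) (hm : 2 ≤ m) (hc : 1 ≤ c) :
    ∃ K : ℕ, ∀ s : ℕ, c ≤ s →
      (2 * c + 2) * (m * s + c).choose (m - 1) ≤
        (missingSets (m * s + c) (familyQ m s c)).card + K * s ^ (m - 2) ∧
      (missingSets (m * s + c) (familyQ m s c)).card ≤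
        (2 * c + 2) * (m * s + c).choose (m - 1) + K * s ^ (m - 2) := by
  obtain ⟨b, rfl⟩ : ∃ b, m = b + 2 := ⟨m - 2, by omega⟩
  rw [show b + 2 - 1 = b + 1 by omega, Nat.add_sub_cancel]
  refine ⟨(2 * c + 2) * ((2 * c + 1) * (b + 2 + c) ^ b) +
    (b + 1) * (b + 2 + c) ^ b * 2 ^ (2 * c + 1), fun s hcs => ?_⟩
  have hbs : 2 * s ≤ (b + 2) * s := Nat.mul_le_mul_right _ (by omega)
  obtain ⟨hlow, hup⟩ := card_light_sets_bounds (n := (b + 2) * s + c) (p := 2 * c + 1)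
    (b := b + 1) (by omega) _ fun P => mem_missingSets_familyQ (P := P)
  have hpow : ((b + 2) * s + c) ^ b ≤ (b + 2 + c) ^ b * s ^ b := by
    rw [← mul_pow]
    exact Nat.pow_le_pow_left (mul_add_le_mul (by omega)) _
  constructor
  · have h1 := choose_succ_le_choose_sub_add ((b + 2) * s + c) (2 * c + 1) b
    have h2 := h1.trans (Nat.add_le_add_left (Nat.mul_le_mul_left (2 * c + 1) hpow) _)
    have h3 := Nat.mul_le_mul_left (2 * c + 2) h2
    have h4 : 0 ≤ (b + 1) * (b + 2 + c) ^ b * 2 ^ (2 * c + 1) * s ^ b := Nat.zero_le _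
    nlinarith
  · have h1 : ((b + 2) * s + c - (2 * c + 1)).choose (b + 1) ≤ ((b + 2) * s + c).choose (b + 1) :=
      Nat.choose_le_choose _ (Nat.sub_le _ _)
    have h2 := Nat.mul_le_mul_left (2 * c + 2) h1
    have h3 := card_powerset_filter_card_lt_le (Finset.Icc 1 ((b + 2) * s + c - (2 * c + 1))) b
    rw [Nat.card_Icc, Nat.add_sub_cancel] at h3
    have h4 : ((b + 2) * s + c - (2 * c + 1) + 1) ^ b ≤ (b + 2 + c) ^ b * s ^ b :=
      (Nat.pow_le_pow_left (by omega) _).trans hpow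
    have h5 := h3.trans (Nat.mul_le_mul_left (b + 1) h4)
    have h6 := Nat.mul_le_mul_right (2 ^ (2 * c + 1)) h5
    have h7 : 0 ≤ (2 * c + 2) * ((2 * c + 1) * (b + 2 + c) ^ b) * s ^ b := Nat.zero_le _
    nlinarith

theorem theoremt (m c : ℕ) (hm : 2 ≤ m) (hc : 1 ≤ c) :
    (∃ K : ℝ, ∀ s : ℕ, c ≤ s → ∀ F : Finset (Finset ℕ),
      F ⊆ (Finset.Icc 1 (m * s + c)).powerset →
      IsShifted (m * s + c) F →
      matchingNumber F < s →
      ¬ F ⊆ familyQ m s c →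
      (c = 1 → ¬ F ⊆ familyW m s c) →
      (2 * (c : ℝ) + 3) * ((m * s + c).choose (m - 1) : ℝ) - K * (s : ℝ) ^ (m - 2)
        ≤ ((missingSets (m * s + c) F).card : ℝ)) ∧
    (∃ K : ℝ, ∀ s : ℕ, c ≤ s →
      |((missingSets (m * s + c) (familyQ m s c)).card : ℝ)
          - (2 * (c : ℝ) + 2) * ((m * s + c).choose (m - 1) : ℝ)|
        ≤ K * (s : ℝ) ^ (m - 2)) := by
  constructor
  · obtain ⟨K, hK⟩ := exists_mul_choose_le_card_missingSets m c hm hc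
    refine ⟨K, fun s hcs F hFn hF hν hQ hW => ?_⟩
    have h : (2 * (c : ℝ) + 3) * ((m * s + c).choose (m - 1) : ℝ) ≤
        ((missingSets (m * s + c) F).card : ℝ) + K * (s : ℝ) ^ (m - 2) := by
      exact_mod_cast hK s hcs F hFn hF hν hQ hW
    linarith
  · obtain ⟨K, hK⟩ := exists_card_missingSets_familyQ_bounds m c hm hc
    refine ⟨K, fun s hcs => ?_⟩
    obtain ⟨h1, h2⟩ := hK s hcs
    have h1' : (2 * (c : ℝ) + 2) * ((m * s + c).choose (m - 1) : ℝ) ≤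
        ((missingSets (m * s + c) (familyQ m s c)).card : ℝ) + K * (s : ℝ) ^ (m - 2) := by
      exact_mod_cast h1
    have h2' : ((missingSets (m * s + c) (familyQ m s c)).card : ℝ) ≤
        (2 * (c : ℝ) + 2) * ((m * s + c).choose (m - 1) : ℝ) + K * (s : ℝ) ^ (m - 2) := by
      exact_mod_cast h2
    rw [abs_le]
    constructor <;> linarith
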